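/- Let $S$ be a finite set of places of $\mathbb Q$ containing the archimedean place $\infty$, let $\mathbb A_S=\prod_{v\in S}\mathbb Q_v$, let $\mathbb Q_S=\{q\in\mathbb Q : |q|_v\le 1 \text{ for all } v\notin S\}$, $\Gamma=\mathbb Q_S^*$ acting on $\mathbb A_S$ by multiplication (diagonal embedding), $\Gamma_+=\Gamma\cap\mathbb Q_{>0}$, and let $X_S=\mathbb A_S/\Gamma$ be the semilocal adèle class space with projection $\pi_S:\mathbb A_S\to X_S$. Equip $\mathbb A_S$ with the product of the Haar measures of $\mathbb Q_p$ giving $\mathbb Z_p$ mass $1$ and of Lebesgue measure on $\mathbb R$, and $X_S$ with the quotient measure, normalized without summation over $\pm1$, i.e. the image under $\pi_S$ of the restriction of the measure of $\mathbb A_S$ to the fundamental domain $\prod_{p\in S\setminus\{\infty\}}\mathbb Z_p^*\times\mathbb R$ of $\Gamma_+$ (so that for $S=\{\infty\}$, $L^2(X_S)$ is the space of even functions in $L^2(\mathbb R)$ with the norm of $L^2(\mathbb R)$). Let $R_S=\prod_{p\in S\setminus\{\infty\}}\mathbb Z_p$. For $f:\mathbb R\to\mathbb C$ even put $$\eta_S(f)(x)=\sum_{\gamma\in\Gamma_+}(1_{R_S}\otimes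 f)(\gamma\tilde x),\qquad \pi_S(\tilde x)=x .$$ Let $\xi_\infty(x)=2^{1/4}e^{-\pi x^2}$ and $\xi_S=\eta_S(\xi_\infty)$. Let $\exp(it\mathbb S)$, $t\in\mathbb R$, be the unitary scaling group on $L^2(X_S)$, $(\exp(it\mathbb S)F)(x)=\lambda^{1/2}F(\lambda x)$ with $\lambda=e^t$, where $\lambda$ acts on $X_S$ by multiplication of the archimedean component. Then the series defining $\xi_S$ converges absolutely for almost every $\tilde x\in\mathbb A_S$, $\xi_S\in L^2(X_S)$, and for every $t\in\mathbb R$ $$\langle\exp(it\mathbb S)\xi_S\,|\,\xi_S\rangle=\sum_{(a,b)}\frac{\sqrt2}{\sqrt{a^2e^t+b^2e^{-t}}},$$ where the (convergent) sum is over all pairs $(a,b)$ of relatively prime elements of $\Gamma_+\cap\mathbb Z$. -/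

import Mathlib

open MeasureTheory
open scoped ENNReal Pointwise

noncomputable section

namespace Semilocal

/-- The finite places of `ℚ`, i.e. the prime numbers. -/
abbrev PrimePlace : Type := {p : ℕ // p.Prime}

instance instFactPrime (p : PrimePlace) : Fact p.1.Prime := ⟨p.2⟩

instance instMeasurableSpacePadic (p : ℕ) [Fact p.Prime] : MeasurableSpace ℚ_[p] := borel _

instance instBorelSpacePadic (p : ℕ) [Fact p.Prime] : BorelSpace ℚ_[p] := ⟨rfl⟩

/-- The additive Haar measure on `ℚ_p` for which `ℤ_p` has measure one. -/
def padicHaar (p : ℕ) [Fact p.Prime] : Measure ℚ_[p] :=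
  Measure.addHaarMeasure
    ⟨⟨Metric.closedBall 0 1, isCompact_closedBall 0 1⟩,
      ⟨0, Metric.ball_subset_interior_closedBall (Metric.mem_ball_self one_pos)⟩⟩

instance instIsAddHaarMeasurePadicHaar (p : ℕ) [Fact p.Prime] :
    (padicHaar p).IsAddHaarMeasure := by
  unfold padicHaar; infer_instance

/-! A finite set of places of `ℚ` containing the archimedean one is encoded by the finite set `S`
of its finite places, i.e. of primes. -/

/-- The locally compact ring `𝔸_S = ∏_{v ∈ S} ℚ_v` (first the finite places, then `ℝ`). -/
abbrev AdeleRing (S : Finset PrimePlace) : Type :=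
  (∀ p : S, ℚ_[p.1.1]) × ℝ

/-- The product of the normalized Haar measures of the `ℚ_p` and of Lebesgue measure on `ℝ`. -/
def adeleHaar (S : Finset PrimePlace) : Measure (AdeleRing S) :=
  (Measure.pi fun p : S => padicHaar p.1.1).prod volume

/-- The ring `ℚ_S` of the rational numbers `q` with `|q|_v ≤ 1` for all `v ∉ S`. -/
def ratS (S : Finset PrimePlace) : Subring ℚ where
  carrier := {q | ∀ p : PrimePlace, p ∉ S → ‖(q : ℚ_[p.1])‖ ≤ 1}
  mul_mem' := by
    intro a b ha hb p hp
    rw [Rat.cast_mul, norm_mul]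
    exact mul_le_one₀ (ha p hp) (norm_nonneg _) (hb p hp)
  one_mem' := by intro p _; simp
  add_mem' := by
    intro a b ha hb p hp
    rw [Rat.cast_add]
    exact (Padic.nonarchimedean _ _).trans (max_le (ha p hp) (hb p hp))
  zero_mem' := by intro p _; simp
  neg_mem' := by
    intro a ha p hp
    rw [Rat.cast_neg, norm_neg]
    exact ha p hp

/-- The group `Γ = ℚ_S^*`. It acts on `𝔸_S` by multiplication through the diagonal embedding
of `ℚ_S`. -/
abbrev Gamma (S : Finset PrimePlace) : Type := (ratS S)ˣ

/-- The rational number underlying an element of `Γ`. -/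
def Gamma.toRat {S : Finset PrimePlace} (γ : Gamma S) : ℚ := ((γ : ratS S) : ℚ)

/-- The group `Γ_+ = Γ ∩ ℚ_+`. -/
def gammaPos (S : Finset PrimePlace) : Subgroup (Gamma S) where
  carrier := {γ | 0 < γ.toRat}
  mul_mem' := by
    intro a b ha hb
    exact mul_pos (a := a.toRat) (b := b.toRat) ha hb
  one_mem' := by
    show (0 : ℚ) < 1
    exact one_pos
  inv_mem' := by
    intro a ha
    have h : a.toRat * (a⁻¹).toRat = 1 := by
      have h1 : ((a : ratS S) * ((a⁻¹ : Gamma S) : ratS S) : ratS S) = 1 := Units.mul_inv a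
      exact congrArg (fun z : ratS S => (z : ℚ)) h1
    exact (pos_iff_pos_of_mul_pos (h ▸ one_pos)).1 ha

lemma gamma_smul_def {S : Finset PrimePlace} (γ : Gamma S) (x : AdeleRing S) :
    γ • x = (fun p => (γ.toRat : ℚ_[p.1.1]) * x.1 p, (γ.toRat : ℝ) * x.2) := by
  refine Prod.ext (funext fun p => ?_) ?_
  · exact Rat.smul_def γ.toRat (x.1 p)
  · exact Rat.smul_def γ.toRat x.2

/-- The semilocal adèle class space `X_S = 𝔸_S / Γ` (with the quotient σ-algebra). -/
abbrev ClassSpace (S : Finset PrimePlace) : Type :=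
  MulAction.orbitRel.Quotient (Gamma S) (AdeleRing S)

/-- The canonical projection `π_S : 𝔸_S → X_S`. -/
def proj (S : Finset PrimePlace) (x : AdeleRing S) : ClassSpace S := Quotient.mk _ x

/-- The set of those `x ∈ 𝔸_S` all of whose non-archimedean components are units,
i.e. `∏_p ℤ_p^* × ℝ`. It is a fundamental domain for `Γ_+`, see
`isFundamentalDomain_unitDomain`. -/
def unitDomain (S : Finset PrimePlace) : Set (AdeleRing S) := {x | ∀ p : S, ‖x.1 p‖ = 1}

lemma smul_unitDomain_disjoint {S : Finset PrimePlace} (γ δ : gammaPos S) (x : AdeleRing S)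
    (h1 : (γ : Gamma S) • x ∈ unitDomain S) (h2 : (δ : Gamma S) • x ∈ unitDomain S) : γ = δ := by
  set q : ℚ := (γ : Gamma S).toRat with hq
  set r : ℚ := (δ : Gamma S).toRat with hr
  have hq0 : 0 < q := γ.2
  have hr0 : 0 < r := δ.2
  have hunit : ∀ (ε : Gamma S) (p : PrimePlace), p ∉ S → ‖((ε.toRat : ℚ) : ℚ_[p.1])‖ = 1 := by
    intro ε p hp
    refine le_antisymm ((ε : ratS S).2 p hp) ?_
    have h3 : ‖(((ε⁻¹).toRat : ℚ) : ℚ_[p.1])‖ ≤ 1 := ((ε⁻¹ : Gamma S) : ratS S).2 p hp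
    have h4 : ε.toRat * (ε⁻¹).toRat = 1 :=
      congrArg (fun z : ratS S => (z : ℚ)) (Units.mul_inv ε)
    have h5 : ‖((ε.toRat : ℚ) : ℚ_[p.1])‖ * ‖(((ε⁻¹).toRat : ℚ) : ℚ_[p.1])‖ = 1 := by
      rw [← norm_mul, ← Rat.cast_mul, h4]; simp
    nlinarith [norm_nonneg ((ε.toRat : ℚ) : ℚ_[p.1])]
  have hnorm : ∀ p : PrimePlace, ‖(q : ℚ_[p.1])‖ = ‖(r : ℚ_[p.1])‖ := by
    intro p
    by_cases hp : p ∈ S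
    · have h3 := h1 ⟨p, hp⟩
      have h4 := h2 ⟨p, hp⟩
      rw [gamma_smul_def] at h3 h4
      simp only [norm_mul] at h3 h4
      have h5 : ‖x.1 ⟨p, hp⟩‖ ≠ 0 := by
        intro h; rw [h, mul_zero] at h3; exact zero_ne_one h3
      exact mul_right_cancel₀ h5 (h3.trans h4.symm)
    · rw [hunit _ p hp, hunit _ p hp]
  have hint : ∀ s : ℚ, (∀ p : PrimePlace, ‖(s : ℚ_[p.1])‖ = 1) → s.den = 1 := by
    intro s hs
    by_contra hd
    obtain ⟨p, hp, hpd⟩ := Nat.exists_prime_and_dvd hd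
    have : Fact p.Prime := ⟨hp⟩
    have h3 : (s : ℚ_[p]) * (s.den : ℚ_[p]) = (s.num : ℚ_[p]) := by
      exact_mod_cast congrArg (fun z : ℚ => (z : ℚ_[p])) (Rat.mul_den_eq_num s)
    have h4 : ‖((s.num : ℤ) : ℚ_[p])‖ < 1 := by
      rw [← h3, norm_mul, hs ⟨p, hp⟩, one_mul]
      exact Padic.norm_natCast_lt_one_iff.2 hpd
    have h5 : (p : ℤ) ∣ s.num := Padic.norm_intCast_lt_one_iff.1 h4
    have h6 : p ∣ Nat.gcd s.num.natAbs s.den :=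
      Nat.dvd_gcd (Int.natCast_dvd.1 h5) hpd
    rw [s.reduced.gcd_eq_one] at h6
    exact hp.one_lt.ne' (Nat.dvd_one.1 h6)
  have hpos : ∀ p : PrimePlace, ‖(q : ℚ_[p.1])‖ ≠ 0 := fun p => by
    rw [norm_ne_zero_iff]; exact_mod_cast hq0.ne'
  have e1 := hint (q / r) fun p => by
    rw [Rat.cast_div, norm_div, ← hnorm p, div_self (hpos p)]
  have e2 := hint (r / q) fun p => by
    rw [Rat.cast_div, norm_div, ← hnorm p, div_self (hpos p)]
  have f1 : ((q / r).num : ℚ) = q / r := Rat.den_eq_one_iff _ |>.1 e1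
  have f2 : ((r / q).num : ℚ) = r / q := Rat.den_eq_one_iff _ |>.1 e2
  have f3 : (1 : ℚ) ≤ q / r := by
    have : 0 < q / r := div_pos hq0 hr0
    rw [← f1] at this ⊢
    exact_mod_cast this
  have f4 : (1 : ℚ) ≤ r / q := by
    have : 0 < r / q := div_pos hr0 hq0
    rw [← f2] at this ⊢
    exact_mod_cast this
  have f5 : q = r := le_antisymm ((one_le_div hq0).1 f4) ((one_le_div hr0).1 f3)
  exact Subtype.ext (Units.ext (Subtype.ext f5))

lemma exists_smul_mem_unitDomain {S : Finset PrimePlace} (x : AdeleRing S)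
    (hx : ∀ p : S, x.1 p ≠ 0) : ∃ γ : gammaPos S, (γ : Gamma S) • x ∈ unitDomain S := by
  let q : ℚ := ∏ p : S, (p.1.1 : ℚ) ^ (-(x.1 p).valuation)
  have hq0 : 0 < q := Finset.prod_pos fun p _ =>
    zpow_pos (by exact_mod_cast p.1.2.pos) _
  have hne : ∀ (l : PrimePlace) (p : S), p.1 ≠ l → ‖((p.1.1 : ℚ) : ℚ_[l.1])‖ = 1 := by
    intro l p h
    rw [Rat.cast_natCast]
    refine le_antisymm (by simpa using Padic.norm_int_le_one (p := l.1) (p.1.1 : ℤ)) (not_lt.1 fun h3 => h ?_)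
    have h4 := Padic.norm_natCast_lt_one_iff.1 h3
    exact Subtype.ext ((Nat.prime_dvd_prime_iff_eq l.2 p.1.2).1 h4).symm
  have hnorm1 : ∀ l : PrimePlace, l ∉ S → ‖(q : ℚ_[l.1])‖ = 1 := by
    intro l hl
    rw [Rat.cast_prod, norm_prod]
    refine Finset.prod_eq_one fun p _ => ?_
    rw [Rat.cast_zpow, norm_zpow, hne l p (fun h => hl (h ▸ p.2)), one_zpow]
  have hnorm2 : ∀ l : S, ‖(q : ℚ_[l.1.1])‖ * ‖x.1 l‖ = 1 := by
    intro l
    rw [Rat.cast_prod, norm_prod, Finset.prod_eq_single l]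
    · rw [Rat.cast_zpow, norm_zpow, Rat.cast_natCast, Padic.norm_p,
        Padic.norm_eq_zpow_neg_valuation (hx l), inv_zpow, zpow_neg, inv_inv]
      have h0 : ((l.1.1 : ℕ) : ℝ) ≠ 0 := Nat.cast_ne_zero.2 l.1.2.ne_zero
      exact mul_inv_cancel₀ (zpow_ne_zero _ h0)
    · intro p _ hp
      rw [Rat.cast_zpow, norm_zpow, hne l.1 p (fun h => hp (Subtype.ext h)), one_zpow]
    · intro h; exact absurd (Finset.mem_univ _) h
  have hmem : q ∈ ratS S := fun l hl => (hnorm1 l hl).le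
  have hmem' : q⁻¹ ∈ ratS S := fun l hl => by
    rw [Rat.cast_inv, norm_inv, hnorm1 l hl, inv_one]
  let γ : Gamma S := ⟨⟨q, hmem⟩, ⟨q⁻¹, hmem'⟩, Subtype.ext (mul_inv_cancel₀ hq0.ne'),
    Subtype.ext (inv_mul_cancel₀ hq0.ne')⟩
  refine ⟨⟨γ, hq0⟩, fun l => ?_⟩
  rw [gamma_smul_def]
  exact (norm_mul _ _).trans (hnorm2 l)

/-- The set `∏_p ℤ_p^* × ℝ` is a fundamental domain for the action of `Γ_+` on `𝔸_S`. -/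
lemma isFundamentalDomain_unitDomain (S : Finset PrimePlace) :
    IsFundamentalDomain (gammaPos S) (unitDomain S) (adeleHaar S) where
  nullMeasurableSet := by
    have : unitDomain S = ⋂ p : S, {x | ‖x.1 p‖ = 1} := by ext x; simp [unitDomain]
    rw [this]
    refine (MeasurableSet.iInter fun p => ?_).nullMeasurableSet
    exact (measurable_norm.comp ((measurable_pi_apply p).comp measurable_fst))
      (measurableSet_singleton 1)
  ae_covers := by
    have h : ∀ᵐ x ∂(adeleHaar S), ∀ p : S, x.1 p ≠ 0 := by
      rw [ae_all_iff]
      intro p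
      exact Measure.quasiMeasurePreserving_fst.ae
        (Measure.ae_eval_ne (fun p : S => padicHaar p.1.1) p 0)
    filter_upwards [h] with x hx
    exact exists_smul_mem_unitDomain x hx
  aedisjoint := by
    intro γ δ hne
    refine Disjoint.aedisjoint (Set.disjoint_left.2 fun x h1 h2 => hne ?_)
    rw [Set.mem_smul_set_iff_inv_smul_mem] at h1 h2
    exact inv_injective (smul_unitDomain_disjoint γ⁻¹ δ⁻¹ x h1 h2)

/-- The quotient measure on `X_S = 𝔸_S / Γ` of the Haar measure of `𝔸_S`, computed from a
fundamental domain of `Γ_+`. In other words `Γ = {±1} × Γ_+` carries the Haar measure that is the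
product of the *probability* measure on `{±1}` and of the counting measure on `Γ_+`. With this
normalization (no summation over `±1`) one has `L²(X_S) = L²(ℝ)^ev`, with the norm of `L²(ℝ)`,
when there is no finite place. -/
def classMeasure (S : Finset PrimePlace) : Measure (ClassSpace S) :=
  ((adeleHaar S).restrict (unitDomain S)).map (proj S)

/-- The Hilbert space `L²(X_S)`. -/
abbrev L2Class (S : Finset PrimePlace) : Type := Lp ℂ 2 (classMeasure S)

/-- The function `1_{R_S} ⊗ f` on `𝔸_S`, where `R_S = ∏_p ℤ_p`. -/
def tensorUnit (S : Finset PrimePlace) (f : ℝ → ℂ) (x : AdeleRing S) : ℂ :=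
  Set.indicator {y : ∀ p : S, ℚ_[p.1.1] | ∀ p, ‖y p‖ ≤ 1} (fun _ => 1) x.1 * f x.2

/-- The function `x ↦ ∑_{γ ∈ Γ_+} (1_{R_S} ⊗ f)(γ x)` on `𝔸_S`. -/
def etaLift (S : Finset PrimePlace) (f : ℝ → ℂ) (x : AdeleRing S) : ℂ :=
  ∑' γ : gammaPos S, tensorUnit S f ((γ : Gamma S) • x)

lemma etaLift_smul_pos {S : Finset PrimePlace} (f : ℝ → ℂ) (δ : gammaPos S) (x : AdeleRing S) :
    etaLift S f ((δ : Gamma S) • x) = etaLift S f x := by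
  unfold etaLift
  rw [← (Equiv.mulRight δ).tsum_eq (fun γ : gammaPos S => tensorUnit S f ((γ : Gamma S) • x))]
  simp [mul_smul]

lemma tensorUnit_neg {S : Finset PrimePlace} {f : ℝ → ℂ} (hf : Function.Even f)
    (x : AdeleRing S) : tensorUnit S f (-x) = tensorUnit S f x := by
  have h : ∀ p : S, ‖(-x).1 p‖ = ‖x.1 p‖ := fun p => norm_neg (x.1 p)
  have h' : f (-x).2 = f x.2 := hf x.2
  simp only [tensorUnit, Set.indicator, Set.mem_ofPred_eq, h, h']

lemma neg_gamma_smul {S : Finset PrimePlace} (γ : Gamma S) (x : AdeleRing S) :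
    (-γ) • x = -(γ • x) := by
  have h : (-γ).toRat = -γ.toRat := rfl
  rw [gamma_smul_def, gamma_smul_def, h]
  refine Prod.ext (funext fun p => ?_) ?_ <;> simp

lemma etaLift_smul {S : Finset PrimePlace} {f : ℝ → ℂ} (hf : Function.Even f)
    (γ : Gamma S) (x : AdeleRing S) : etaLift S f (γ • x) = etaLift S f x := by
  have hneg : ∀ y : AdeleRing S, etaLift S f (-y) = etaLift S f y := by
    intro y
    unfold etaLift
    exact tsum_congr fun δ => by rw [smul_neg, tensorUnit_neg hf]
  have h0 : γ.toRat ≠ 0 := by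
    intro h
    have h1 : (γ : ratS S) = 0 := Subtype.ext h
    exact γ.ne_zero h1
  rcases lt_or_gt_of_ne h0 with h | h
  · have hm : -γ ∈ gammaPos S := by
      show 0 < -γ.toRat
      linarith
    have := etaLift_smul_pos f ⟨-γ, hm⟩ x
    rw [neg_gamma_smul, hneg] at this
    exact this
  · exact etaLift_smul_pos f ⟨γ, h⟩ x

/-- The function `η_S(f)` on `X_S`, for an even function `f` on `ℝ`:
`η_S(f)(x) = ∑_{γ ∈ Γ_+} (1_{R_S} ⊗ f)(γ x̃)` for any `x̃` with `π_S(x̃) = x`. -/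
def eta (S : Finset PrimePlace) (f : ℝ → ℂ) (hf : Function.Even f) : ClassSpace S → ℂ :=
  Quotient.lift (etaLift S f) (by
    rintro _ x ⟨γ, rfl⟩
    exact etaLift_smul hf γ x)

/-- The unit vector `h₀(x) = 2^{1/4} exp(-π x²)` of `L²(ℝ)^ev`. -/
def gaussian (x : ℝ) : ℂ := (((2 : ℝ) ^ (1 / 4 : ℝ) * Real.exp (-Real.pi * x ^ 2) : ℝ) : ℂ)

lemma gaussian_even : Function.Even gaussian := fun x => by simp [gaussian]

/-! ### The scaling group -/

/-- Multiplication by the idèle with archimedean component `e^t` and all other components `1`. -/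
def scaleAdele (S : Finset PrimePlace) (t : ℝ) (x : AdeleRing S) : AdeleRing S :=
  (x.1, Real.exp t * x.2)

/-- The map induced on `X_S` by `scaleAdele`. -/
def scaleClass (S : Finset PrimePlace) (t : ℝ) : ClassSpace S → ClassSpace S :=
  Quotient.map (scaleAdele S t) (by
    rintro _ x ⟨γ, rfl⟩
    refine ⟨γ, ?_⟩
    show γ • scaleAdele S t x = scaleAdele S t (γ • x)
    simp only [gamma_smul_def, scaleAdele]
    exact Prod.ext rfl (mul_left_comm _ _ _))

lemma measurable_proj (S : Finset PrimePlace) : Measurable (proj S) :=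
  measurable_quotient_mk''

lemma measurable_scaleAdele (S : Finset PrimePlace) (t : ℝ) : Measurable (scaleAdele S t) :=
  measurable_fst.prodMk (measurable_snd.const_mul _)

lemma measurable_scaleClass (S : Finset PrimePlace) (t : ℝ) : Measurable (scaleClass S t) :=
  measurable_from_quotient.2 ((measurable_proj S).comp (measurable_scaleAdele S t))

lemma scaleClass_scaleClass (S : Finset PrimePlace) (s t : ℝ) (x : ClassSpace S) :
    scaleClass S s (scaleClass S t x) = scaleClass S (s + t) x := by
  induction x using Quotient.inductionOn with
  | h x =>
    show proj S _ = proj S _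
    simp [scaleAdele, Real.exp_add, mul_assoc]

lemma scaleClass_zero (S : Finset PrimePlace) (x : ClassSpace S) : scaleClass S 0 x = x := by
  induction x using Quotient.inductionOn with
  | h x =>
    show proj S _ = proj S _
    simp [scaleAdele]

lemma unitDomain_eq (S : Finset PrimePlace) :
    unitDomain S = {y | ∀ p : S, ‖y p‖ = 1} ×ˢ Set.univ := by
  ext x; simp [unitDomain]

lemma map_scaleClass (S : Finset PrimePlace) (t : ℝ) :
    (classMeasure S).map (scaleClass S t) =
      ENNReal.ofReal (Real.exp (-t)) • classMeasure S := by
  have h1 : ((adeleHaar S).restrict (unitDomain S)).map (scaleAdele S t) =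
      ENNReal.ofReal (Real.exp (-t)) • (adeleHaar S).restrict (unitDomain S) := by
    rw [unitDomain_eq, adeleHaar, ← Measure.prod_restrict, Measure.restrict_univ]
    have h2 := Measure.map_prod_map
      ((Measure.pi fun p : S => padicHaar p.1.1).restrict
        {y | ∀ p : S, ‖y p‖ = 1}) (volume : Measure ℝ) measurable_id
        (measurable_const_mul (Real.exp t))
    rw [Measure.map_id, Real.map_volume_mul_left (Real.exp_pos t).ne',
      Measure.prod_smul_right, abs_of_pos (inv_pos.2 (Real.exp_pos t)), ← Real.exp_neg] at h2
    exact h2.symm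
  have h3 : scaleClass S t ∘ proj S = proj S ∘ scaleAdele S t := rfl
  rw [classMeasure, Measure.map_map (measurable_scaleClass S t) (measurable_proj S), h3,
    ← Measure.map_map (measurable_proj S) (measurable_scaleAdele S t), h1, Measure.map_smul]

lemma quasiMeasurePreserving_scaleClass (S : Finset PrimePlace) (t : ℝ) :
    Measure.QuasiMeasurePreserving (scaleClass S t) (classMeasure S) (classMeasure S) :=
  ⟨measurable_scaleClass S t, by
    rw [map_scaleClass]
    exact Measure.smul_absolutelyContinuous⟩

/-- `(exp(it𝕊) f)(x) = λ^{1/2} f(λ x)` with `λ = e^t`, on functions on `X_S`. -/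
def scaleFun (S : Finset PrimePlace) (t : ℝ) (f : ClassSpace S → ℂ) (x : ClassSpace S) : ℂ :=
  ((Real.exp t) ^ (1 / 2 : ℝ) : ℝ) * f (scaleClass S t x)

lemma eLpNorm_scaleFun (S : Finset PrimePlace) (t : ℝ) {f : ClassSpace S → ℂ}
    (hf : AEStronglyMeasurable f (classMeasure S)) :
    eLpNorm (scaleFun S t f) 2 (classMeasure S) = eLpNorm f 2 (classMeasure S) := by
  have hf' : AEStronglyMeasurable f ((classMeasure S).map (scaleClass S t)) :=
    hf.mono_ac (quasiMeasurePreserving_scaleClass S t).2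
  have h1 : scaleFun S t f =
      (((Real.exp t) ^ (1 / 2 : ℝ) : ℝ) : ℂ) • (f ∘ scaleClass S t) := rfl
  have hpos : (0 : ℝ) < Real.exp t ^ (1 / 2 : ℝ) := Real.rpow_pos_of_pos (Real.exp_pos t) _
  rw [h1, eLpNorm_const_smul, ← eLpNorm_map_measure hf' (measurable_scaleClass S t).aemeasurable,
    map_scaleClass, eLpNorm_smul_measure_of_ne_top (by simp), smul_eq_mul, ← mul_assoc]
  have h2 : ‖(((Real.exp t) ^ (1 / 2 : ℝ) : ℝ) : ℂ)‖ₑ *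
      ENNReal.ofReal (Real.exp (-t)) ^ (1 / (2 : ℝ≥0∞)).toReal = 1 := by
    rw [← ofReal_norm, Complex.norm_real, Real.norm_of_nonneg hpos.le,
      ENNReal.ofReal_rpow_of_pos (Real.exp_pos _), ← ENNReal.ofReal_mul hpos.le]
    have : (1 / (2 : ℝ≥0∞)).toReal = 1 / 2 := by simp
    rw [this, ← Real.mul_rpow (Real.exp_pos _).le (Real.exp_pos _).le, ← Real.exp_add]
    simp
  rw [h2, one_mul]

lemma memLp_scaleFun (S : Finset PrimePlace) (t : ℝ) {f : ClassSpace S → ℂ}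
    (hf : MemLp f 2 (classMeasure S)) : MemLp (scaleFun S t f) 2 (classMeasure S) :=
  ⟨(hf.1.comp_quasiMeasurePreserving (quasiMeasurePreserving_scaleClass S t)).const_mul _,
    by rw [eLpNorm_scaleFun S t hf.1]; exact hf.2⟩

/-- `scaleFun` on `L²(X_S)`, as a linear isometry. -/
def scalingIsometry (S : Finset PrimePlace) (t : ℝ) : L2Class S →ₗᵢ[ℂ] L2Class S where
  toFun f := (memLp_scaleFun S t (Lp.memLp f)).toLp _
  map_add' f g := by
    rw [← MemLp.toLp_add]
    refine MemLp.toLp_congr _ _ ?_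
    filter_upwards [(quasiMeasurePreserving_scaleClass S t).ae_eq_comp (Lp.coeFn_add f g)]
      with x hx
    simp only [Function.comp_apply, Pi.add_apply] at hx
    simp only [scaleFun, Pi.add_apply, ← mul_add]
    rw [← hx]
  map_smul' c f := by
    rw [RingHom.id_apply, ← MemLp.toLp_const_smul]
    refine MemLp.toLp_congr _ _ ?_
    filter_upwards [(quasiMeasurePreserving_scaleClass S t).ae_eq_comp (Lp.coeFn_smul c f)]
      with x hx
    simp only [Function.comp_apply, Pi.smul_apply, smul_eq_mul] at hx
    simp [scaleFun, hx, mul_left_comm]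
  norm_map' f := by
    show ‖(memLp_scaleFun S t (Lp.memLp f)).toLp _‖ = ‖f‖
    rw [Lp.norm_toLp, eLpNorm_scaleFun S t (Lp.aestronglyMeasurable f), Lp.norm_def]

lemma scalingIsometry_coeFn (S : Finset PrimePlace) (t : ℝ) (f : L2Class S) :
    scalingIsometry S t f =ᵐ[classMeasure S] scaleFun S t f :=
  MemLp.coeFn_toLp (memLp_scaleFun S t (Lp.memLp f))

lemma scalingIsometry_neg (S : Finset PrimePlace) (t : ℝ) (f : L2Class S) :
    scalingIsometry S t (scalingIsometry S (-t) f) = f := by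
  refine Lp.ext ?_
  filter_upwards [scalingIsometry_coeFn S t (scalingIsometry S (-t) f),
    (quasiMeasurePreserving_scaleClass S t).ae_eq_comp (scalingIsometry_coeFn S (-t) f)]
    with x h1 h2
  simp only [Function.comp_apply] at h2
  rw [h1, scaleFun, h2, scaleFun, scaleClass_scaleClass, neg_add_cancel, scaleClass_zero,
    ← mul_assoc, ← Complex.ofReal_mul, ← Real.mul_rpow (Real.exp_pos _).le (Real.exp_pos _).le,
    ← Real.exp_add]
  simp

/-- The unitary operator `exp(it𝕊)`, `t ∈ ℝ`, of the scaling group acting on `L²(X_S)`: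
`(exp(it𝕊) f)(x) = λ^{1/2} f(λ x)` with `λ = e^t`. -/
def scaling (S : Finset PrimePlace) (t : ℝ) : L2Class S ≃ₗᵢ[ℂ] L2Class S :=
  LinearIsometryEquiv.ofSurjective (scalingIsometry S t)
    fun f => ⟨scalingIsometry S (-t) f, scalingIsometry_neg S t f⟩

/-- The pairs `(a, b)` of relatively prime elements of `Γ_+ ∩ ℤ`. -/
def coprimePairs (S : Finset PrimePlace) : Set (ℤ × ℤ) :=
  {ab | IsCoprime ab.1 ab.2 ∧ (∃ γ ∈ gammaPos S, γ.toRat = ab.1) ∧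
    (∃ γ ∈ gammaPos S, γ.toRat = ab.2)}

end Semilocal

end

noncomputable section

namespace Semilocal

/-! Every element of `Γ_+` is a unit at the primes outside `S`. If all finite components of `x` are
units, `γ x` lies in `R_S × ℝ` exactly when `γ` is integral at the primes of `S` too, that is, when
`γ` is a positive integer with all prime factors in `S`. On the fundamental domain `ξ_S` is
therefore `∑ h(n x_∞)` over such `n`, with `h` the normalized gaussian (`tsum_enorm_tensorUnit`).

All terms are positive, so the scalar product can be expanded in `[0, ∞]` by Tonelli: it equals the
volume `∏ (1 - 1/p)` of `∏ ℤ_p^*` times the sum over pairs `(m, n)` of the gaussian integrals `√2 /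
√(m² e^t + n² e^{-t})`. This expression is homogeneous of degree `-1`. Writing `(m, n) = d (a, b)`
with `a`, `b` coprime splits off `∑ 1/d`, whose Euler product is `∏ (1 - 1/p)⁻¹` and cancels the
volume exactly (`tsum_correlation_eq`, `lintegral_eta_gaussian`).

Convergence follows from `m² e^t + n² e^{-t} ≥ 2mn`: each term is at most `(mn)^{-1/2}`, and `∑
n^{-1/2}` is a finite product of geometric series. The case `t = 0` gives `ξ_S ∈ L²`. -/

/-! ### Integers with all prime factors in `S`, as elements of `Γ_+` -/

/-- The positive integers all of whose prime factors lie in `S`. -/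
abbrev natS (S : Finset PrimePlace) : Set ℕ := Nat.factoredNumbers (S.image Subtype.val)

lemma mem_natS {S : Finset PrimePlace} {n : ℕ} :
    n ∈ natS S ↔ ∀ p : PrimePlace, p.1 ∣ n → p ∈ S := by
  rw [Nat.mem_factoredNumbers']
  constructor
  · intro h p hp
    obtain ⟨q, hq, e⟩ := Finset.mem_image.1 (h p.1 p.2 hp)
    rwa [← Subtype.ext e]
  · exact fun h p hp hd => Finset.mem_image.2 ⟨⟨p, hp⟩, h ⟨p, hp⟩ hd, rfl⟩

lemma natS_pos {S : Finset PrimePlace} (n : natS S) : 0 < n.1 :=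
  Nat.pos_of_ne_zero (Nat.ne_zero_of_mem_factoredNumbers n.2)

lemma toRat_mul_toRat_inv {S : Finset PrimePlace} (γ : Gamma S) :
    γ.toRat * (γ⁻¹).toRat = 1 :=
  congrArg (fun z : ratS S => (z : ℚ)) (Units.mul_inv γ)

lemma toRat_injective (S : Finset PrimePlace) :
    Function.Injective (Gamma.toRat : Gamma S → ℚ) := fun _ _ h =>
  Units.ext (Subtype.ext h)

instance instCountableGamma (S : Finset PrimePlace) : Countable (Gamma S) :=
  (toRat_injective S).countable

lemma norm_toRat_eq_one {S : Finset PrimePlace} (γ : Gamma S) {p : PrimePlace} (hp : p ∉ S) :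
    ‖(γ.toRat : ℚ_[p.1])‖ = 1 := by
  refine le_antisymm ((γ : ratS S).2 p hp) ?_
  have h1 : ‖((γ⁻¹).toRat : ℚ_[p.1])‖ ≤ 1 := ((γ⁻¹ : Gamma S) : ratS S).2 p hp
  have h2 : ‖(γ.toRat : ℚ_[p.1])‖ * ‖((γ⁻¹).toRat : ℚ_[p.1])‖ = 1 := by
    rw [← norm_mul, ← Rat.cast_mul, toRat_mul_toRat_inv]; simp
  nlinarith [norm_nonneg (γ.toRat : ℚ_[p.1])]

lemma norm_natCast_eq_one {S : Finset PrimePlace} (n : natS S) {p : PrimePlace} (hp : p ∉ S) :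
    ‖((n.1 : ℚ) : ℚ_[p.1])‖ = 1 := by
  rw [Rat.cast_natCast]
  refine le_antisymm (by simpa using Padic.norm_int_le_one (p := p.1) (n.1 : ℤ))
    (not_lt.1 fun h => hp (mem_natS.1 n.2 p (Padic.norm_natCast_lt_one_iff.1 h)))

/-- A positive integer with all prime factors in `S`, as an element of `Γ_+`. -/
def gammaOfNat {S : Finset PrimePlace} (n : natS S) : gammaPos S :=
  ⟨⟨⟨n.1, fun _ hp => (norm_natCast_eq_one n hp).le⟩,
    ⟨(n.1 : ℚ)⁻¹, fun _ hp => by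
      rw [Rat.cast_inv, norm_inv, norm_natCast_eq_one n hp, inv_one]⟩,
    Subtype.ext (mul_inv_cancel₀ (Nat.cast_ne_zero.2 (natS_pos n).ne')),
    Subtype.ext (inv_mul_cancel₀ (Nat.cast_ne_zero.2 (natS_pos n).ne'))⟩,
    show (0 : ℚ) < n.1 from Nat.cast_pos.2 (natS_pos n)⟩

lemma toRat_gammaOfNat {S : Finset PrimePlace} (n : natS S) :
    (gammaOfNat n : Gamma S).toRat = n.1 := rfl

lemma gammaOfNat_injective (S : Finset PrimePlace) :
    Function.Injective (gammaOfNat : natS S → gammaPos S) := fun m n h => by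
  have h1 := congrArg (fun γ : gammaPos S => (γ : Gamma S).toRat) h
  simp only [toRat_gammaOfNat] at h1
  exact Subtype.ext (Nat.cast_injective h1)

/-- A prime dividing the denominator would also divide the numerator, since `|num|_p = |q|_p |den|_p
< 1`; the fraction is reduced. -/
lemma den_eq_one_of_norm_le_one {q : ℚ} (hq : ∀ p : PrimePlace, ‖(q : ℚ_[p.1])‖ ≤ 1) :
    q.den = 1 := by
  by_contra hd
  obtain ⟨p, hp, hpd⟩ := Nat.exists_prime_and_dvd hd
  have : Fact p.Prime := ⟨hp⟩
  have h1 : (q : ℚ_[p]) * (q.den : ℚ_[p]) = (q.num : ℚ_[p]) := by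
    exact_mod_cast congrArg (fun z : ℚ => (z : ℚ_[p])) (Rat.mul_den_eq_num q)
  have h2 : ‖((q.num : ℤ) : ℚ_[p])‖ < 1 := by
    rw [← h1, norm_mul]
    exact (mul_le_of_le_one_left (norm_nonneg _) (hq ⟨p, hp⟩)).trans_lt
      (Padic.norm_natCast_lt_one_iff.2 hpd)
  have h3 : (p : ℤ) ∣ q.num := Padic.norm_intCast_lt_one_iff.1 h2
  have h4 : p ∣ Nat.gcd q.num.natAbs q.den := Nat.dvd_gcd (Int.natCast_dvd.1 h3) hpd
  rw [q.reduced.gcd_eq_one] at h4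
  exact hp.one_lt.ne' (Nat.dvd_one.1 h4)

lemma mem_natS_of_toRat_eq {S : Finset PrimePlace} {γ : Gamma S} {n : ℕ}
    (h : γ.toRat = n) : n ∈ natS S := by
  refine mem_natS.2 fun p hp => by_contra fun hS => ?_
  have h1 := norm_toRat_eq_one γ hS
  rw [h, Rat.cast_natCast] at h1
  exact (Padic.norm_natCast_lt_one_iff.2 hp).ne h1

/-- This determines which `γ` contribute to `ξ_S` on the unit domain: integrality outside `S` is
automatic, so integrality at `S` makes `γ` a positive integer. -/
lemma exists_gammaOfNat_eq {S : Finset PrimePlace} (γ : gammaPos S)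
    (h : ∀ p : S, ‖((γ : Gamma S).toRat : ℚ_[p.1.1])‖ ≤ 1) : ∃ n : natS S, gammaOfNat n = γ := by
  have h1 : (γ : Gamma S).toRat.den = 1 := den_eq_one_of_norm_le_one fun p => by
    by_cases hp : p ∈ S
    · exact h ⟨p, hp⟩
    · exact (norm_toRat_eq_one _ hp).le
  have h2 := (Rat.den_eq_one_iff _).1 h1
  have h3 : 0 < (γ : Gamma S).toRat := γ.2
  have h4 : 0 < (γ : Gamma S).toRat.num := Rat.num_pos.2 h3
  have h5 : (γ : Gamma S).toRat = ((γ : Gamma S).toRat.num.toNat : ℕ) := by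
    conv_lhs => rw [← h2]
    rw [← Int.cast_natCast, Int.toNat_of_nonneg h4.le]
  exact ⟨⟨_, mem_natS_of_toRat_eq h5⟩, Subtype.ext (toRat_injective S h5.symm)⟩

lemma exists_mem_gammaPos_iff {S : Finset PrimePlace} {a : ℤ} :
    (∃ γ ∈ gammaPos S, γ.toRat = a) ↔ ∃ n : natS S, (n.1 : ℤ) = a := by
  constructor
  · rintro ⟨γ, h0, h⟩
    have h1 : (0 : ℚ) < γ.toRat := h0
    rw [h, Int.cast_pos] at h1
    have h2 : γ.toRat = (a.toNat : ℕ) := by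
      rw [h, ← Int.cast_natCast, Int.toNat_of_nonneg h1.le]
    exact ⟨⟨_, mem_natS_of_toRat_eq h2⟩, Int.toNat_of_nonneg h1.le⟩
  · rintro ⟨n, rfl⟩
    exact ⟨gammaOfNat n, (gammaOfNat n).2, by rw [toRat_gammaOfNat, Int.cast_natCast]⟩

/-! ### Pairs of integers and their greatest common divisor -/

/-- Reindexing of pairs by their greatest common divisor and the associated coprime pair. -/
lemma exists_equiv_coprimePairs (S : Finset PrimePlace) :
    ∃ e : natS S × coprimePairs S ≃ natS S × natS S, ∀ x,
      ((e x).1.1 : ℤ) = x.1.1 * x.2.1.1 ∧ ((e x).2.1 : ℤ) = x.1.1 * x.2.1.2 := by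
  have hex : ∀ c : coprimePairs S, ∃ ab : natS S × natS S,
      (ab.1.1 : ℤ) = c.1.1 ∧ (ab.2.1 : ℤ) = c.1.2 := fun c => by
    obtain ⟨a, ha⟩ := exists_mem_gammaPos_iff.1 c.2.2.1
    obtain ⟨b, hb⟩ := exists_mem_gammaPos_iff.1 c.2.2.2
    exact ⟨(a, b), ha, hb⟩
  choose g hg1 hg2 using hex
  have hcop : ∀ c, Nat.Coprime (g c).1.1 (g c).2.1 := fun c => by
    rw [← Nat.isCoprime_iff_coprime, hg1, hg2]
    exact c.2.1
  let f : natS S × coprimePairs S → natS S × natS S := fun x =>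
    (⟨x.1.1 * (g x.2).1.1, Nat.mul_mem_factoredNumbers x.1.2 (g x.2).1.2⟩,
      ⟨x.1.1 * (g x.2).2.1, Nat.mul_mem_factoredNumbers x.1.2 (g x.2).2.2⟩)
  have hf1 : ∀ x, (f x).1.1 = x.1.1 * (g x.2).1.1 := fun _ => rfl
  have hf2 : ∀ x, (f x).2.1 = x.1.1 * (g x.2).2.1 := fun _ => rfl
  -- The factor `d` is recovered as the gcd of the image pair; injectivity follows by cancelling it.
  have hgcd : ∀ x, Nat.gcd (f x).1.1 (f x).2.1 = x.1.1 := fun x => by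
    rw [hf1, hf2, Nat.gcd_mul_left, (hcop x.2).gcd_eq_one, mul_one]
  have hbij : Function.Bijective f := by
    constructor
    · intro x y h
      have h0 : x.1.1 = y.1.1 := by rw [← hgcd x, ← hgcd y, h]
      have h1 : (g x.2).1.1 = (g y.2).1.1 := by
        refine Nat.eq_of_mul_eq_mul_left (natS_pos x.1) ?_
        rw [← hf1 x, h, hf1, h0]
      have h2 : (g x.2).2.1 = (g y.2).2.1 := by
        refine Nat.eq_of_mul_eq_mul_left (natS_pos x.1) ?_
        rw [← hf2 x, h, hf2, h0]
      refine Prod.ext (Subtype.ext h0) (Subtype.ext (Prod.ext ?_ ?_))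
      · rw [← hg1, ← hg1, h1]
      · rw [← hg2, ← hg2, h2]
    · rintro ⟨m, n⟩
      obtain ⟨a, ha⟩ := Nat.gcd_dvd_left m.1 n.1
      obtain ⟨b, hb⟩ := Nat.gcd_dvd_right m.1 n.1
      have hd : 0 < Nat.gcd m.1 n.1 := Nat.gcd_pos_of_pos_left _ (natS_pos m)
      have hab : Nat.Coprime a b := by
        refine Nat.eq_of_mul_eq_mul_left hd ?_
        rw [← Nat.gcd_mul_left, ← ha, ← hb, mul_one]
      have haS : a ∈ natS S := Nat.mem_factoredNumbers_of_dvd m.2 ⟨_, ha.trans (mul_comm _ _)⟩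
      have hbS : b ∈ natS S := Nat.mem_factoredNumbers_of_dvd n.2 ⟨_, hb.trans (mul_comm _ _)⟩
      let c : coprimePairs S := ⟨(a, b), Nat.isCoprime_iff_coprime.2 hab,
        exists_mem_gammaPos_iff.2 ⟨⟨a, haS⟩, rfl⟩, exists_mem_gammaPos_iff.2 ⟨⟨b, hbS⟩, rfl⟩⟩
      have hc1 : (g c).1.1 = a := Int.ofNat_injective (hg1 c)
      have hc2 : (g c).2.1 = b := Int.ofNat_injective (hg2 c)
      refine ⟨(⟨Nat.gcd m.1 n.1, Nat.mem_factoredNumbers_of_dvd m.2 (Nat.gcd_dvd_left _ _)⟩, c),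
        Prod.ext (Subtype.ext ?_) (Subtype.ext ?_)⟩
      · rw [hf1, hc1, ← ha]
      · rw [hf2, hc2, ← hb]
  refine ⟨Equiv.ofBijective f hbij, fun x => ⟨?_, ?_⟩⟩
  · rw [Equiv.ofBijective_apply, hf1, Nat.cast_mul, hg1]
  · rw [Equiv.ofBijective_apply, hf2, Nat.cast_mul, hg2]

/-! ### Finite Euler products -/

lemma prod_image_primes (S : Finset PrimePlace) (f : ℕ → ℝ) :
    ∏ p ∈ S.image Subtype.val with p.Prime, f p = ∏ p : S, f p.1.1 := by
  rw [Finset.filter_true_of_mem, Finset.prod_image Subtype.val_injective.injOn,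
    ← Finset.prod_coe_sort]
  intro p hp
  obtain ⟨q, _, rfl⟩ := Finset.mem_image.1 hp
  exact q.2

/-- The value is the inverse of the volume of `∏ ℤ_p^*` found in `pi_padicHaar_unitPart`. -/
lemma hasSum_natS_inv (S : Finset PrimePlace) :
    HasSum (fun n : natS S => ((n.1 : ℝ))⁻¹) (∏ p : S, (1 - (p.1.1 : ℝ)⁻¹)⁻¹) := by
  let f : ℕ →* ℝ := ⟨⟨fun n => (n : ℝ)⁻¹, by simp⟩, fun a b => by simp [mul_comm]⟩
  have h := (EulerProduct.summable_and_hasSum_factoredNumbers_prod_filter_prime_geometric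
    (f := f) (fun {p} hp => ?_) (S.image Subtype.val)).2
  · rwa [prod_image_primes S fun p => (1 - f p)⁻¹] at h
  · show ‖(p : ℝ)⁻¹‖ < 1
    rw [norm_inv, Real.norm_natCast]
    exact inv_lt_one_of_one_lt₀ (by exact_mod_cast hp.one_lt)

/-- Only finitely many primes occur, so it suffices that each geometric ratio `p^{-1/2}` is below
one. -/
lemma summable_natS_inv_sqrt (S : Finset PrimePlace) :
    Summable (fun n : natS S => (√(n.1 : ℝ))⁻¹) := by
  let f : ℕ →* ℝ := ⟨⟨fun n => (√(n : ℝ))⁻¹, by simp⟩, fun a b => by simp [mul_comm]⟩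
  refine (EulerProduct.summable_and_hasSum_factoredNumbers_prod_filter_prime_geometric
    (f := f) (fun {p} hp => ?_) (S.image Subtype.val)).2.summable
  show ‖(√(p : ℝ))⁻¹‖ < 1
  rw [norm_inv, Real.norm_of_nonneg (Real.sqrt_nonneg _)]
  exact inv_lt_one_of_one_lt₀ (Real.lt_sqrt_of_sq_lt (by rw [one_pow]; exact_mod_cast hp.one_lt))

/-! ### Haar measure of the `p`-adic units -/

/-- This is the decomposition of `ℤ_p` into residue classes modulo `p`: the open unit ball is the
maximal ideal `pℤ_p`. -/
lemma iUnion_ball_add_eq_closedBall (p : ℕ) [Fact p.Prime] :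
    ⋃ i : Fin p, ((i.1 : ℚ_[p]) +ᵥ Metric.ball (0 : ℚ_[p]) 1) = Metric.closedBall 0 1 := by
  ext x
  simp only [Set.mem_iUnion, Set.mem_vadd_set_iff_neg_vadd_mem, vadd_eq_add,
    mem_ball_zero_iff, mem_closedBall_zero_iff]
  constructor
  · rintro ⟨i, hi⟩
    have h1 : ‖(i.1 : ℚ_[p])‖ ≤ 1 := by simpa using Padic.norm_int_le_one (p := p) (i.1 : ℤ)
    have h2 : x = (i.1 : ℚ_[p]) + (-(i.1 : ℚ_[p]) + x) := by ring
    rw [h2]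
    exact (Padic.nonarchimedean _ _).trans (max_le h1 hi.le)
  · intro hx
    obtain ⟨z, rfl⟩ : ∃ z : ℤ_[p], (z : ℚ_[p]) = x := ⟨⟨x, hx⟩, rfl⟩
    obtain ⟨n, hn, h⟩ := PadicInt.exists_mem_range z
    rw [IsLocalRing.mem_maximalIdeal, PadicInt.mem_nonunits] at h
    refine ⟨⟨n, hn⟩, ?_⟩
    rw [neg_add_eq_sub]
    rwa [PadicInt.norm_def, PadicInt.coe_sub, PadicInt.coe_natCast] at h

lemma padicHaar_closedBall (p : ℕ) [Fact p.Prime] :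
    padicHaar p (Metric.closedBall 0 1) = 1 :=
  Measure.addHaarMeasure_self

/-- The `p` residue classes are disjoint translates of the open ball, so they share the mass one of
`ℤ_p` equally. -/
lemma padicHaar_ball (p : ℕ) [Fact p.Prime] :
    p * padicHaar p (Metric.ball 0 1) = 1 := by
  rw [← padicHaar_closedBall p, ← iUnion_ball_add_eq_closedBall, measure_iUnion]
  · simp_rw [measure_vadd]
    simp
  · intro i j hij
    refine Set.disjoint_left.2 fun x hi hj => hij ?_
    simp only [Set.mem_vadd_set_iff_neg_vadd_mem, vadd_eq_add, mem_ball_zero_iff] at hi hj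
    -- If two classes meet at `x`, the ultrametric inequality gives `p ∣ i - j`, which with `|i - j|
    -- < p` forces `i = j`.
    have h1 : ‖(((i.1 : ℤ) - (j.1 : ℤ) : ℤ) : ℚ_[p])‖ < 1 := by
      have e : (((i.1 : ℤ) - (j.1 : ℤ) : ℤ) : ℚ_[p]) =
          (-(j.1 : ℚ_[p]) + x) + -(-(i.1 : ℚ_[p]) + x) := by push_cast; ring
      rw [e]
      refine (Padic.nonarchimedean _ _).trans_lt (max_lt hj ?_)
      rwa [norm_neg]
    have h2 := Padic.norm_intCast_lt_one_iff.1 h1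
    have h3 := Int.eq_zero_of_abs_lt_dvd h2 (by rw [abs_lt]; constructor <;> omega)
    exact Fin.ext (by omega)
  · intro i
    exact measurableSet_ball.const_vadd _

lemma padicHaar_norm_eq_one (p : ℕ) [Fact p.Prime] :
    padicHaar p {x | ‖x‖ = 1} = ENNReal.ofReal (1 - (p : ℝ)⁻¹) := by
  have hp : (p : ℝ≥0∞) ≠ 0 := by exact_mod_cast (Fact.out : p.Prime).ne_zero
  have h1 : padicHaar p (Metric.ball 0 1) = (p : ℝ≥0∞)⁻¹ := by
    rw [← one_mul (padicHaar p _), ← ENNReal.inv_mul_cancel hp (ENNReal.natCast_ne_top p),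
      mul_assoc, padicHaar_ball, mul_one]
  have h2 : {x : ℚ_[p] | ‖x‖ = 1} = Metric.closedBall 0 1 \ Metric.ball 0 1 := by
    ext x; simp [le_antisymm_iff]
  rw [h2, measure_sdiff Metric.ball_subset_closedBall measurableSet_ball.nullMeasurableSet
    (by rw [h1]; exact ENNReal.inv_ne_top.2 hp), h1, padicHaar_closedBall,
    ENNReal.ofReal_sub _ (by positivity), ENNReal.ofReal_one, ENNReal.ofReal_inv_of_pos
    (by exact_mod_cast (Fact.out : p.Prime).pos), ENNReal.ofReal_natCast]

/-- The set `∏_p ℤ_p^*` of the non-archimedean parts of the points of `unitDomain S`. -/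
def unitPart (S : Finset PrimePlace) : Set (∀ p : S, ℚ_[p.1.1]) := {y | ∀ p, ‖y p‖ = 1}

lemma pi_padicHaar_unitPart (S : Finset PrimePlace) :
    Measure.pi (fun p : S => padicHaar p.1.1) (unitPart S) =
      ENNReal.ofReal (∏ p : S, (1 - (p.1.1 : ℝ)⁻¹)) := by
  have h : unitPart S = Set.univ.pi fun p : S => {x : ℚ_[p.1.1] | ‖x‖ = 1} := by
    ext y; simp [unitPart]
  rw [h, Measure.pi_pi, ENNReal.ofReal_prod_of_nonneg]
  · exact Finset.prod_congr rfl fun p _ => padicHaar_norm_eq_one _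
  · intro p _
    exact sub_nonneg.2 (inv_le_one_of_one_le₀ (by exact_mod_cast p.1.2.one_le))

/-! ### Gaussian sums and integrals on the real line -/

/-- The real-valued function `2^{1/4} exp(-π x²)`. -/
def realGaussian (x : ℝ) : ℝ := (2 : ℝ) ^ (1 / 4 : ℝ) * Real.exp (-Real.pi * x ^ 2)

lemma realGaussian_pos (x : ℝ) : 0 < realGaussian x := by unfold realGaussian; positivity

lemma measurable_realGaussian : Measurable realGaussian := by
  unfold realGaussian; fun_prop

lemma summable_realGaussian {x : ℝ} (hx : x ≠ 0) :
    Summable fun n : ℕ => realGaussian (n * x) := by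
  refine Summable.mul_left _ ?_
  have h0 : (0 : ℝ) < Real.pi * x ^ 2 := by positivity
  refine Summable.of_nonneg_of_le (fun n => (Real.exp_pos _).le) (fun n => ?_)
    (summable_geometric_of_lt_one (Real.exp_pos (-(Real.pi * x ^ 2))).le
      (Real.exp_lt_one_iff.2 (neg_lt_zero.2 h0)))
  rw [← Real.exp_nat_mul]
  refine Real.exp_le_exp.2 ?_
  -- Replacing `n²` by `n` in the exponent gives the dominating geometric series.
  have h1 : (n : ℝ) ≤ (n : ℝ) ^ 2 := by exact_mod_cast Nat.le_self_pow two_ne_zero n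
  nlinarith

lemma lintegral_realGaussian_mul {a : ℝ} (ha : 0 < a) (b : ℝ) :
    ∫⁻ x : ℝ, ENNReal.ofReal (realGaussian (a * x)) * ENNReal.ofReal (realGaussian (b * x)) =
      ENNReal.ofReal (√2 / √(a ^ 2 + b ^ 2)) := by
  have hc : 0 < Real.pi * (a ^ 2 + b ^ 2) := by positivity
  have h1 : ∀ x : ℝ, realGaussian (a * x) * realGaussian (b * x) =
      √2 * Real.exp (-(Real.pi * (a ^ 2 + b ^ 2)) * x ^ 2) := fun x => by
    have h2 : (2 : ℝ) ^ (1 / 4 : ℝ) * (2 : ℝ) ^ (1 / 4 : ℝ) = √2 := by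
      rw [← Real.rpow_add two_pos, Real.sqrt_eq_rpow]; norm_num
    rw [realGaussian, realGaussian, mul_mul_mul_comm, h2, ← Real.exp_add]
    ring_nf
  simp_rw [← ENNReal.ofReal_mul (realGaussian_pos _).le, h1]
  rw [← ofReal_integral_eq_lintegral_ofReal ((integrable_exp_neg_mul_sq hc).const_mul _)
    (Filter.Eventually.of_forall fun x => by positivity), integral_const_mul, integral_gaussian]
  congr 1
  rw [div_mul_cancel_left₀ Real.pi_ne_zero, Real.sqrt_inv, ← div_eq_mul_inv]

/-- The sum `∑ 2^{1/4} exp(-π n² x²)` over the positive integers `n` with all prime factors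
in `S`. -/
def gaussianSum (S : Finset PrimePlace) (x : ℝ) : ℝ≥0∞ :=
  ∑' n : natS S, ENNReal.ofReal (realGaussian (n.1 * x))

lemma measurable_gaussianSum (S : Finset PrimePlace) : Measurable (gaussianSum S) :=
  Measurable.tsum fun _ =>
    (measurable_realGaussian.comp (measurable_const_mul _)).ennreal_ofReal

lemma gaussianSum_ne_top (S : Finset PrimePlace) {x : ℝ} (hx : x ≠ 0) :
    gaussianSum S x ≠ ∞ :=
  ((summable_realGaussian hx).comp_injective
    (Subtype.val_injective (p := (· ∈ natS S)))).tsum_ofReal_ne_top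

/-! ### Correlations of dilated gaussians and their sum over pairs -/

/-- The scalar product `λ^{1/2} ∫ h(λ m x) h(n x) dx`, with `λ = e^t` and `h` the normalized
gaussian. -/
def correlation (t a b : ℝ) : ℝ := √2 / √(a ^ 2 * Real.exp t + b ^ 2 * Real.exp (-t))

lemma correlation_nonneg (t a b : ℝ) : 0 ≤ correlation t a b := by
  unfold correlation; positivity

lemma correlation_mul {d : ℝ} (hd : 0 < d) (t a b : ℝ) :
    correlation t (d * a) (d * b) = d⁻¹ * correlation t a b := by
  have h : (d * a) ^ 2 * Real.exp t + (d * b) ^ 2 * Real.exp (-t) =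
      d ^ 2 * (a ^ 2 * Real.exp t + b ^ 2 * Real.exp (-t)) := by ring
  rw [correlation, correlation, h, Real.sqrt_mul (sq_nonneg d), Real.sqrt_sq hd.le]
  field_simp

/-- The inequality `a² e^t + b² e^{-t} ≥ 2ab` removes `t` and separates the variables, so the double
sum is dominated by a product of two convergent sums. -/
lemma correlation_le {a b : ℝ} (ha : 0 < a) (hb : 0 < b) (t : ℝ) :
    correlation t a b ≤ (√a)⁻¹ * (√b)⁻¹ := by
  rw [correlation, ← mul_inv, ← Real.sqrt_mul ha.le, ← Real.sqrt_inv, ← Real.sqrt_div two_pos.le]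
  refine Real.sqrt_le_sqrt ?_
  rw [inv_eq_one_div, div_le_div_iff₀ (by positivity) (by positivity), one_mul]
  have h1 : Real.exp (t / 2) * Real.exp (-(t / 2)) = 1 := by rw [← Real.exp_add]; simp
  have h2 : Real.exp t = Real.exp (t / 2) ^ 2 := by rw [← Real.exp_nat_mul]; congr 1; push_cast; ring
  have h3 : Real.exp (-t) = Real.exp (-(t / 2)) ^ 2 := by
    rw [← Real.exp_nat_mul]; congr 1; push_cast; ring
  rw [h2, h3]
  have h4 := two_mul_le_add_sq (a * Real.exp (t / 2)) (b * Real.exp (-(t / 2)))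
  have h5 : 2 * (a * Real.exp (t / 2)) * (b * Real.exp (-(t / 2))) = 2 * (a * b) := by
    linear_combination 2 * a * b * h1
  nlinarith

lemma exp_half_mul_lintegral (t : ℝ) {m : ℝ} (hm : 0 < m) (n : ℝ) :
    ENNReal.ofReal (Real.exp t ^ (1 / 2 : ℝ)) * ∫⁻ x : ℝ,
      ENNReal.ofReal (realGaussian (m * (Real.exp t * x))) *
        ENNReal.ofReal (realGaussian (n * x)) = ENNReal.ofReal (correlation t m n) := by
  simp_rw [← mul_assoc m]
  rw [lintegral_realGaussian_mul (mul_pos hm (Real.exp_pos t)),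
    ← ENNReal.ofReal_mul (by positivity)]
  congr 1
  -- Pulling `e^t` out of the square root cancels the prefactor `e^{t/2}` and leaves the symmetric
  -- form.
  have h1 : (m * Real.exp t) ^ 2 + n ^ 2 =
      Real.exp t * (m ^ 2 * Real.exp t + n ^ 2 * Real.exp (-t)) := by
    rw [Real.exp_neg]; field_simp
  rw [correlation, h1, Real.sqrt_mul (Real.exp_pos t).le, ← Real.sqrt_eq_rpow]
  have h2 : √(Real.exp t) ≠ 0 := (Real.sqrt_pos.2 (Real.exp_pos t)).ne'
  field_simp

lemma exp_half_mul_lintegral_gaussianSum (S : Finset PrimePlace) (t : ℝ) :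
    ENNReal.ofReal (Real.exp t ^ (1 / 2 : ℝ)) *
      ∫⁻ x : ℝ, gaussianSum S (Real.exp t * x) * gaussianSum S x =
    ∑' mn : natS S × natS S, ENNReal.ofReal (correlation t mn.1.1 mn.2.1) := by
  rw [ENNReal.tsum_prod (f := fun m n : natS S => ENNReal.ofReal (correlation t m.1 n.1))]
  have hm : ∀ m n : natS S, Measurable fun x : ℝ =>
      ENNReal.ofReal (realGaussian (m.1 * (Real.exp t * x))) *
        ENNReal.ofReal (realGaussian (n.1 * x)) := fun m n =>
    (measurable_realGaussian.comp ((measurable_const_mul _).comp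
      (measurable_const_mul (Real.exp t)))).ennreal_ofReal.mul
    (measurable_realGaussian.comp (measurable_const_mul _)).ennreal_ofReal
  simp_rw [gaussianSum, ← ENNReal.tsum_mul_right, ← ENNReal.tsum_mul_left]
  rw [lintegral_tsum fun m => (Measurable.tsum fun n => hm m n).aemeasurable,
    ← ENNReal.tsum_mul_left]
  refine tsum_congr fun m => ?_
  rw [lintegral_tsum fun n => (hm m n).aemeasurable, ← ENNReal.tsum_mul_left]
  exact tsum_congr fun n => exp_half_mul_lintegral t (Nat.cast_pos.2 (natS_pos m)) _

lemma tsum_correlation_ne_top (S : Finset PrimePlace) (t : ℝ) :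
    ∑' mn : natS S × natS S, ENNReal.ofReal (correlation t mn.1.1 mn.2.1) ≠ ∞ := by
  refine ne_top_of_le_ne_top ?_ (ENNReal.tsum_le_tsum fun mn => ENNReal.ofReal_le_ofReal
    (correlation_le (Nat.cast_pos.2 (natS_pos mn.1)) (Nat.cast_pos.2 (natS_pos mn.2)) t))
  exact ((summable_natS_inv_sqrt S).mul_of_nonneg (summable_natS_inv_sqrt S)
    (fun _ => by positivity) (fun _ => by positivity)).tsum_ofReal_ne_top

/-- By homogeneity, `(m, n) = d (a, b)` turns the double sum into `∑ 1/d` times the sum over coprime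
pairs. -/
lemma tsum_correlation_eq (S : Finset PrimePlace) (t : ℝ) :
    ∑' mn : natS S × natS S, ENNReal.ofReal (correlation t mn.1.1 mn.2.1) =
      ENNReal.ofReal (∏ p : S, (1 - (p.1.1 : ℝ)⁻¹)⁻¹) *
        ∑' ab : coprimePairs S, ENNReal.ofReal (correlation t ab.1.1 ab.1.2) := by
  obtain ⟨e, he⟩ := exists_equiv_coprimePairs S
  rw [← e.tsum_eq, ← (hasSum_natS_inv S).tsum_eq,
    ENNReal.ofReal_tsum_of_nonneg (fun _ => by positivity) (hasSum_natS_inv S).summable,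
    ← ENNReal.tsum_mul_right]
  simp_rw [← ENNReal.tsum_mul_left]
  rw [← ENNReal.tsum_prod (f := fun (d : natS S) (ab : coprimePairs S) =>
    ENNReal.ofReal ((d.1 : ℝ)⁻¹) * ENNReal.ofReal (correlation t ab.1.1 ab.1.2))]
  refine tsum_congr fun x => ?_
  have h1 : ((e x).1.1 : ℝ) = x.1.1 * x.2.1.1 := by exact_mod_cast (he x).1
  have h2 : ((e x).2.1 : ℝ) = x.1.1 * x.2.1.2 := by exact_mod_cast (he x).2
  rw [h1, h2, correlation_mul (Nat.cast_pos.2 (natS_pos x.1)), ENNReal.ofReal_mul (by positivity)]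

/-! ### The function `η_S(ξ_∞)` -/

/-- The values are nonnegative reals; stated as `z = ‖z‖`, this permits computing with sums in `[0,
∞]`. -/
lemma tensorUnit_gaussian (S : Finset PrimePlace) (x : AdeleRing S) :
    tensorUnit S gaussian x = ((‖tensorUnit S gaussian x‖ : ℝ) : ℂ) := by
  have h : gaussian x.2 = ((realGaussian x.2 : ℝ) : ℂ) := rfl
  rw [tensorUnit, h]
  by_cases hx : x.1 ∈ {y : ∀ p : S, ℚ_[p.1.1] | ∀ p, ‖y p‖ ≤ 1}
  · rw [Set.indicator_of_mem hx, one_mul, Complex.norm_real,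
      Real.norm_of_nonneg (realGaussian_pos _).le]
  · rw [Set.indicator_of_notMem hx, zero_mul, norm_zero, Complex.ofReal_zero]

lemma measurable_smul_adele {S : Finset PrimePlace} (γ : Gamma S) :
    Measurable fun x : AdeleRing S => γ • x := by
  simp_rw [gamma_smul_def]
  exact (measurable_pi_lambda _ fun p =>
    ((measurable_pi_apply p).comp measurable_fst).const_mul _).prodMk (measurable_snd.const_mul _)

lemma measurable_tensorUnit_gaussian (S : Finset PrimePlace) :
    Measurable (tensorUnit S gaussian) := by
  have h1 : MeasurableSet {y : ∀ p : S, ℚ_[p.1.1] | ∀ p, ‖y p‖ ≤ 1} := by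
    rw [Set.ofPred_forall]
    exact MeasurableSet.iInter fun p => measurableSet_le (measurable_pi_apply p).norm
      measurable_const
  exact ((measurable_const.indicator h1).comp measurable_fst).mul
    ((Complex.measurable_ofReal.comp measurable_realGaussian).comp measurable_snd)

/-- No summability is needed: where the series diverges, both sides take the default value zero.
Measurability of `ξ_S` thus reduces to that of a sum in `[0, ∞]`. -/
lemma etaLift_gaussian (S : Finset PrimePlace) (x : AdeleRing S) :
    etaLift S gaussian x =
      (((∑' γ : gammaPos S, ‖tensorUnit S gaussian ((γ : Gamma S) • x)‖ₑ).toReal : ℝ) : ℂ) := by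
  rw [ENNReal.tsum_toReal_eq fun _ => enorm_ne_top, Complex.ofReal_tsum]
  refine tsum_congr fun γ => ?_
  rw [toReal_enorm]
  exact tensorUnit_gaussian S _

lemma measurable_etaLift_gaussian (S : Finset PrimePlace) :
    Measurable (etaLift S gaussian) := by
  rw [funext (etaLift_gaussian S)]
  exact Complex.measurable_ofReal.comp (Measurable.tsum fun γ =>
    ((measurable_tensorUnit_gaussian S).comp (measurable_smul_adele _)).enorm).ennreal_toReal

lemma measurable_eta_gaussian (S : Finset PrimePlace) :
    Measurable (eta S gaussian gaussian_even) :=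
  measurable_from_quotient.2 (measurable_etaLift_gaussian S)

lemma eta_gaussian_eq_norm (S : Finset PrimePlace) (c : ClassSpace S) :
    eta S gaussian gaussian_even c = ((‖eta S gaussian gaussian_even c‖ : ℝ) : ℂ) := by
  induction c using Quotient.inductionOn with
  | h x =>
    show etaLift S gaussian x = ((‖etaLift S gaussian x‖ : ℝ) : ℂ)
    rw [etaLift_gaussian, Complex.norm_real, Real.norm_of_nonneg ENNReal.toReal_nonneg]

lemma tensorUnit_gammaOfNat {S : Finset PrimePlace} {x : AdeleRing S} (hx : x ∈ unitDomain S)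
    (n : natS S) : tensorUnit S gaussian ((gammaOfNat n : Gamma S) • x) =
      ((realGaussian (n.1 * x.2) : ℝ) : ℂ) := by
  rw [gamma_smul_def, toRat_gammaOfNat, tensorUnit, Set.indicator_of_mem, one_mul]
  · simp [gaussian, realGaussian]
  · intro p
    rw [norm_mul, hx p, mul_one, Rat.cast_natCast]
    simpa using Padic.norm_int_le_one (p := p.1.1) (n.1 : ℤ)

lemma tensorUnit_eq_zero {S : Finset PrimePlace} {x : AdeleRing S} (hx : x ∈ unitDomain S)
    {γ : gammaPos S} (hγ : γ ∉ Set.range (gammaOfNat : natS S → gammaPos S)) (f : ℝ → ℂ) :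
    tensorUnit S f ((γ : Gamma S) • x) = 0 := by
  rw [gamma_smul_def, tensorUnit, Set.indicator_of_notMem, zero_mul]
  intro h
  refine hγ (exists_gammaOfNat_eq γ fun p => ?_)
  have h1 := h p
  rwa [norm_mul, hx p, mul_one] at h1

lemma tsum_enorm_tensorUnit {S : Finset PrimePlace} {x : AdeleRing S} (hx : x ∈ unitDomain S) :
    ∑' γ : gammaPos S, ‖tensorUnit S gaussian ((γ : Gamma S) • x)‖ₑ = gaussianSum S x.2 := by
  rw [← (gammaOfNat_injective S).tsum_eq, gaussianSum]
  · refine tsum_congr fun n => ?_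
    rw [tensorUnit_gammaOfNat hx, ← ofReal_norm, Complex.norm_real,
      Real.norm_of_nonneg (realGaussian_pos _).le]
  · intro γ hγ
    by_contra h
    exact hγ (by simp only [tensorUnit_eq_zero hx h, enorm_zero])

/-- The point `x.2 = 0` is excluded because there `gaussianSum` can be infinite while the complex
series has default value zero. -/
lemma enorm_etaLift_gaussian {S : Finset PrimePlace} {x : AdeleRing S} (hx : x ∈ unitDomain S)
    (h0 : x.2 ≠ 0) : ‖etaLift S gaussian x‖ₑ = gaussianSum S x.2 := by
  rw [etaLift_gaussian, tsum_enorm_tensorUnit hx, ← ofReal_norm, Complex.norm_real,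
    Real.norm_of_nonneg ENNReal.toReal_nonneg, ENNReal.ofReal_toReal (gaussianSum_ne_top S h0)]

lemma summable_tensorUnit_of_mem_unitDomain {S : Finset PrimePlace} {x : AdeleRing S}
    (hx : x ∈ unitDomain S) (h0 : x.2 ≠ 0) :
    Summable fun γ : gammaPos S => tensorUnit S gaussian ((γ : Gamma S) • x) := by
  rw [← (gammaOfNat_injective S).summable_iff fun γ hγ => tensorUnit_eq_zero hx hγ gaussian]
  simp only [Function.comp_def, tensorUnit_gammaOfNat hx, Complex.summable_ofReal]
  exact (summable_realGaussian h0).comp_injective (Subtype.val_injective (p := (· ∈ natS S)))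

lemma ae_summable_tensorUnit_gaussian (S : Finset PrimePlace) :
    ∀ᵐ x ∂(adeleHaar S), Summable fun γ : gammaPos S =>
      tensorUnit S gaussian ((γ : Gamma S) • x) := by
  have h1 : ∀ᵐ x ∂(adeleHaar S), ∀ p : S, x.1 p ≠ 0 := by
    rw [ae_all_iff]
    intro p
    exact Measure.quasiMeasurePreserving_fst.ae
      (Measure.ae_eval_ne (fun p : S => padicHaar p.1.1) p 0)
  have h2 : ∀ᵐ x ∂(adeleHaar S), x.2 ≠ 0 :=
    Measure.quasiMeasurePreserving_snd.ae (Measure.ae_ne volume 0)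
  filter_upwards [h1, h2] with x hx hx0
  obtain ⟨δ, hδ⟩ := exists_smul_mem_unitDomain x hx
  have h3 : ((δ : Gamma S) • x).2 ≠ 0 := by
    have h4 : (0 : ℚ) < (δ : Gamma S).toRat := δ.2
    rw [gamma_smul_def]
    exact mul_ne_zero (by exact_mod_cast h4.ne') hx0
  -- Translating the index by `δ` moves `x` into the unit domain without affecting summability.
  rw [← (Equiv.mulRight δ).summable_iff]
  simpa [Function.comp_def, mul_smul] using summable_tensorUnit_of_mem_unitDomain hδ h3

/-! ### Norm and scalar products of `ξ_S` -/

/-- The scalar product of `exp(it𝕊) ξ_S` and `ξ_S`, as an integral with values in `[0, ∞]`. -/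
lemma lintegral_eta_gaussian (S : Finset PrimePlace) (t : ℝ) :
    ENNReal.ofReal (Real.exp t ^ (1 / 2 : ℝ)) * ∫⁻ c, ‖eta S gaussian gaussian_even
        (scaleClass S t c)‖ₑ * ‖eta S gaussian gaussian_even c‖ₑ ∂(classMeasure S) =
      ∑' ab : coprimePairs S, ENNReal.ofReal (correlation t ab.1.1 ab.1.2) := by
  have hU : MeasurableSet (unitPart S) := by
    rw [unitPart, Set.ofPred_forall]
    exact MeasurableSet.iInter fun p => measurableSet_eq_fun (measurable_pi_apply p).norm
      measurable_const
  have hm : Measurable fun x : ℝ => gaussianSum S (Real.exp t * x) * gaussianSum S x :=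
    ((measurable_gaussianSum S).comp (measurable_const_mul _)).mul (measurable_gaussianSum S)
  have hμ : (adeleHaar S).restrict (unitDomain S) =
      ((Measure.pi fun p : S => padicHaar p.1.1).restrict (unitPart S)).prod volume := by
    rw [unitDomain_eq, adeleHaar, ← Measure.prod_restrict, Measure.restrict_univ]; rfl
  have hD : MeasurableSet (unitDomain S) := by
    rw [unitDomain_eq]; exact hU.prod MeasurableSet.univ
  have hη : Measurable fun c => ‖eta S gaussian gaussian_even (scaleClass S t c)‖ₑ *
      ‖eta S gaussian gaussian_even c‖ₑ :=
    ((measurable_eta_gaussian S).comp (measurable_scaleClass S t)).enorm.mul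
      (measurable_eta_gaussian S).enorm
  rw [classMeasure, lintegral_map hη (measurable_proj S)]
  have hae : ∀ᵐ x ∂((adeleHaar S).restrict (unitDomain S)),
      ‖eta S gaussian gaussian_even (scaleClass S t (proj S x))‖ₑ *
        ‖eta S gaussian gaussian_even (proj S x)‖ₑ =
      -- The factor `1` is the function of the finite components, which brings the integrand into
      -- the product form used by `lintegral_prod_mul`.
      1 * (gaussianSum S (Real.exp t * x.2) * gaussianSum S x.2) := by
    have h2 : ∀ᵐ x ∂((adeleHaar S).restrict (unitDomain S)), x.2 ≠ 0 := by
      rw [hμ]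
      exact Measure.quasiMeasurePreserving_snd.ae (Measure.ae_ne volume 0)
    filter_upwards [h2, ae_restrict_mem hD] with x hx0 hx
    -- Scaling changes only the real component, so the unit domain is stable.
    have hs : scaleAdele S t x ∈ unitDomain S := hx
    rw [one_mul]
    exact congrArg₂ _ (enorm_etaLift_gaussian hs (mul_ne_zero (Real.exp_pos t).ne' hx0))
      (enorm_etaLift_gaussian hx hx0)
  rw [lintegral_congr_ae hae, hμ, lintegral_prod_mul (f := fun _ => 1) aemeasurable_const
    hm.aemeasurable, lintegral_one, Measure.restrict_apply_univ, pi_padicHaar_unitPart,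
    mul_left_comm, exp_half_mul_lintegral_gaussianSum, tsum_correlation_eq, ← mul_assoc,
    ← ENNReal.ofReal_mul, ← Finset.prod_mul_distrib]
  · rw [Finset.prod_eq_one, ENNReal.ofReal_one, one_mul]
    intro p _
    refine mul_inv_cancel₀ (sub_ne_zero.2 (ne_of_gt ?_))
    exact inv_lt_one_of_one_lt₀ (by exact_mod_cast p.1.2.one_lt)
  · exact Finset.prod_nonneg fun p _ =>
      sub_nonneg.2 (inv_le_one_of_one_le₀ (by exact_mod_cast p.1.2.one_le))

/-- The sum over all pairs is finite and is a positive multiple of this one. -/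
lemma tsum_coprimePairs_ne_top (S : Finset PrimePlace) (t : ℝ) :
    ∑' ab : coprimePairs S, ENNReal.ofReal (correlation t ab.1.1 ab.1.2) ≠ ∞ := by
  intro h
  refine tsum_correlation_ne_top S t ?_
  rw [tsum_correlation_eq, h, ENNReal.mul_top]
  rw [Ne, ENNReal.ofReal_eq_zero, not_le]
  exact Finset.prod_pos fun p _ => inv_pos.2 (sub_pos.2
    (inv_lt_one_of_one_lt₀ (by exact_mod_cast p.1.2.one_lt)))

lemma memLp_eta_gaussian (S : Finset PrimePlace) :
    MemLp (eta S gaussian gaussian_even) 2 (classMeasure S) := by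
  refine ⟨(measurable_eta_gaussian S).aestronglyMeasurable, ?_⟩
  rw [eLpNorm_lt_top_iff_lintegral_rpow_enorm_lt_top two_ne_zero ENNReal.ofNat_ne_top]
  -- At `t = 0` scaling is trivial, and the scalar product becomes the squared norm.
  have h := lintegral_eta_gaussian S 0
  simp only [Real.exp_zero, Real.one_rpow, ENNReal.ofReal_one, one_mul, scaleClass_zero] at h
  simp only [ENNReal.toReal_ofNat, ENNReal.rpow_ofNat, sq]
  rw [h]
  exact (tsum_coprimePairs_ne_top S 0).lt_top

lemma inner_scaling_eta_gaussian (S : Finset PrimePlace) (t : ℝ)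
    (h : MemLp (eta S gaussian gaussian_even) 2 (classMeasure S)) :
    inner ℂ (scaling S t (h.toLp _)) (h.toLp _) =
      (((∑' ab : coprimePairs S, ENNReal.ofReal (correlation t ab.1.1 ab.1.2)).toReal : ℝ) : ℂ) := by
  have h1 : scaling S t (h.toLp _) =ᵐ[classMeasure S]
      scaleFun S t (eta S gaussian gaussian_even) := by
    refine (scalingIsometry_coeFn S t (h.toLp _)).trans ?_
    filter_upwards [(quasiMeasurePreserving_scaleClass S t).ae_eq_comp h.coeFn_toLp] with c hc
    simp only [Function.comp_apply] at hc
    rw [scaleFun, scaleFun, hc]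
  -- Since `ξ_S` equals its own norm pointwise, complex conjugation disappears and the integral
  -- becomes one of a nonnegative function.
  have h2 : ∀ᵐ c ∂(classMeasure S), inner ℂ (scaling S t (h.toLp _) c) (h.toLp _ c) =
      ((Real.exp t ^ (1 / 2 : ℝ) * (‖eta S gaussian gaussian_even (scaleClass S t c)‖ *
        ‖eta S gaussian gaussian_even c‖) : ℝ) : ℂ) := by
    filter_upwards [h1, h.coeFn_toLp] with c hc1 hc2
    rw [hc1, hc2, scaleFun, eta_gaussian_eq_norm S (scaleClass S t c), eta_gaussian_eq_norm S c]
    simp [Complex.conj_ofReal]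
    ring
  have hp : (0 : ℝ) ≤ Real.exp t ^ (1 / 2 : ℝ) := by positivity
  rw [L2.inner_def, integral_congr_ae h2, integral_complex_ofReal, integral_const_mul,
    integral_eq_lintegral_of_nonneg_ae, ← lintegral_eta_gaussian, ENNReal.toReal_mul,
    ENNReal.toReal_ofReal hp]
  · simp_rw [ENNReal.ofReal_mul (norm_nonneg _), ofReal_norm]
  · exact Filter.Eventually.of_forall fun c => by positivity
  · exact (((measurable_eta_gaussian S).comp (measurable_scaleClass S t)).norm.mul
      (measurable_eta_gaussian S).norm).aestronglyMeasurable

end Semilocal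

end

theorem mainTheorem5 (S : Finset Semilocal.PrimePlace) :
    (∀ᵐ x ∂(Semilocal.adeleHaar S), Summable fun γ : Semilocal.gammaPos S =>
      Semilocal.tensorUnit S Semilocal.gaussian ((γ : Semilocal.Gamma S) • x)) ∧
    ∃ h : MeasureTheory.MemLp (Semilocal.eta S Semilocal.gaussian Semilocal.gaussian_even) 2
        (Semilocal.classMeasure S),
      ∀ t : ℝ, HasSum
        (fun ab : Semilocal.coprimePairs S =>
          ((√2 / √((ab.1.1 : ℝ) ^ 2 * Real.exp t + (ab.1.2 : ℝ) ^ 2 * Real.exp (-t)) : ℝ) : ℂ))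
        (inner ℂ (Semilocal.scaling S t (h.toLp _)) (h.toLp _)) := by
  refine ⟨Semilocal.ae_summable_tensorUnit_gaussian S, Semilocal.memLp_eta_gaussian S,
    fun t => ?_⟩
  rw [Semilocal.inner_scaling_eta_gaussian, Complex.hasSum_ofReal,
    ENNReal.tsum_toReal_eq fun _ => ENNReal.ofReal_ne_top]
  have h := ENNReal.hasSum_toReal (Semilocal.tsum_coprimePairs_ne_top S t)
  simp only [ENNReal.toReal_ofReal (Semilocal.correlation_nonneg _ _ _)] at h ⊢
  exact h
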